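/- Let $A$ be an infinite-dimensional unital C*-algebra and let $(A_n)_{n\ge 0}$ be an increasing sequence of finite-dimensional *-subalgebras of $A$, each containing the unit of $A$, with $A_0=\mathbb C1$ and with norm-dense union (so $A$ is AF). Let $A$ act on a complex Hilbert space $H$ by a unital *-representation, and let $\xi\in H$ be a unit vector that is separating ($a\in A$, $a\xi=0$ imply $a=0$) and cyclic ($A\xi$ is dense in $H$) for $A$. Put $H_n=A_n\xi$, let $P_n$ be the orthogonal projection of $H$ onto $H_n$, and put $Q_0=P_0$, $Q_n=P_n-P_{n-1}$ for $n\ge1$; thus $Q_n$ is the orthogonal projection onto $F_n$, where $F_0=H_0$ and $F_n=H_n\ominus H_{n-1}$ for $n\ge 1$. For a real sequence $\alpha=(\alpha_n)_{n\ge0}$ let $D=\sum_{n}\alpha_nQ_n$, with domain $\{x\in H:\sum_n\|\alpha_nQ_nx\|^2<\infty\}$. For a bounded operator $a$ on $H$ we write $\|[D,a]\|\le C$ if $a$ maps $\operatorname{dom}D$ into itself and $\|Dax-aDx\|\le C\|x\|$ for all $x\in\operatorname{dom}D$. Put $\mathcal D=\{a=a^*\in A:\|[D,a]\|\le 1\}$.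 (i) There is a real sequence $\alpha$ with $\alpha_0=0$ and $\alpha_n>0$ for $n\ge1$ such that the following hold. - For every $n$, $\{x\in\operatorname{dom}D:Dx=\alpha_nx\}=F_n$. - $D$ is unbounded and $(H,D)$ is an unbounded Fredholm module over $A$: $D$ is densely defined and self-adjoint, the set of $a\in A$ with $\|[D,a]\|\le C$ for some $C<\infty$ is norm dense in $A$, and $(I+D^2)^{-1}$ is a compact operator. - $\mathcal D$ separates the states of $A$, and the image of $\mathcal D$ in $A/\mathbb C1$ is precompact for the quotient norm. - $d(\varphi,\psi)=\sup\{|\varphi(a)-\psi(a)|:a\in\mathcal D\}$ is a (finite) metric on the state space of $A$, and its topology is the weak*-topology. (ii) For every $p>0$ the sequence $\alpha$ in (i) can be chosen so that, moreover, the module is $p$-summable: $\operatorname{trace}\big((I+D^2)^{-p/2}\big)<\infty$. -/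

import Mathlib

open scoped ComplexOrder

noncomputable section

/-- An approximating sequence exhibiting a unital C*-algebra `A` as an AF algebra: an increasing
sequence of finite-dimensional *-subalgebras containing the unit, starting with the scalars
(`⊥` is `ℂ 1`), with norm-dense union. -/
structure AFSequence (A : Type*) [CStarAlgebra A] where
  alg : ℕ → StarSubalgebra ℂ A
  mono : Monotone alg
  alg_zero : alg 0 = ⊥
  finiteDimensional : ∀ n, FiniteDimensional ℂ (alg n)
  dense : Dense (⋃ n, (alg n : Set A))

/-- The state space of a unital C*-algebra: positive functionals of value `1` at `1`. As a subset of
`WeakDual ℂ A`, it carries the weak*-topology. -/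
def StateSpace (A : Type*) [CStarAlgebra A] : Set (WeakDual ℂ A) :=
  {φ | (∀ a : A, 0 ≤ φ (star a * a)) ∧ φ 1 = 1}

section Representation

variable {A H : Type*} [CStarAlgebra A] [NormedAddCommGroup H] [InnerProductSpace ℂ H]
  [CompleteSpace H]

/-- `ξ` is separating: `a ξ = 0` only for `a = 0`. -/
def IsSeparatingVector (π : A →⋆ₐ[ℂ] (H →L[ℂ] H)) (ξ : H) : Prop :=
  ∀ a : A, π a ξ = 0 → a = 0

/-- `ξ` is cyclic: the vectors `a ξ` are dense in `H`. -/
def IsCyclicVector (π : A →⋆ₐ[ℂ] (H →L[ℂ] H)) (ξ : H) : Prop :=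
  Dense (Set.range fun a : A => π a ξ)

/-- The linear map `a ↦ a ξ`. -/
def orbitMap (π : A →⋆ₐ[ℂ] (H →L[ℂ] H)) (ξ : H) : A →ₗ[ℂ] H where
  toFun a := π a ξ
  map_add' a b := by simp
  map_smul' c a := by simp

/-- `H_n = A_n ξ`. -/
def filtrationSpace (π : A →⋆ₐ[ℂ] (H →L[ℂ] H)) (ξ : H) (𝒜 : AFSequence A) (n : ℕ) :
    Submodule ℂ H :=
  (𝒜.alg n).toSubalgebra.toSubmodule.map (orbitMap π ξ)

instance (π : A →⋆ₐ[ℂ] (H →L[ℂ] H)) (ξ : H) (𝒜 : AFSequence A) (n : ℕ) :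
    FiniteDimensional ℂ (filtrationSpace π ξ 𝒜 n) := by
  have : FiniteDimensional ℂ (𝒜.alg n).toSubalgebra.toSubmodule := 𝒜.finiteDimensional n
  unfold filtrationSpace
  infer_instance

/-- `F_0 = H_0` and `F_n = H_n ⊖ H_{n-1}` for `n ≥ 1`. -/
def differenceSpace (π : A →⋆ₐ[ℂ] (H →L[ℂ] H)) (ξ : H) (𝒜 : AFSequence A) : ℕ → Submodule ℂ H
  | 0 => filtrationSpace π ξ 𝒜 0
  | n + 1 => filtrationSpace π ξ 𝒜 (n + 1) ⊓ (filtrationSpace π ξ 𝒜 n)ᗮ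

/-- With `P_n` the orthogonal projection onto `H_n`: `Q_0 = P_0` and `Q_n = P_n - P_{n-1}` for
`n ≥ 1`. -/
def differenceProj (π : A →⋆ₐ[ℂ] (H →L[ℂ] H)) (ξ : H) (𝒜 : AFSequence A) : ℕ → (H →L[ℂ] H)
  | 0 => (filtrationSpace π ξ 𝒜 0).starProjection
  | n + 1 => (filtrationSpace π ξ 𝒜 (n + 1)).starProjection -
      (filtrationSpace π ξ 𝒜 n).starProjection

end Representation

section Operators

variable {H : Type*} [NormedAddCommGroup H] [InnerProductSpace ℂ H]

/-- The operator `∑ α_n Q_n` on its maximal domain, the set of all `x` for which the series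
`∑ α_n Q_n x` converges unconditionally (for mutually orthogonal projections: for which
`∑ ‖α_n Q_n x‖ ^ 2 < ∞`). -/
def diagonalOperator (Q : ℕ → (H →L[ℂ] H)) (α : ℕ → ℝ) : H →ₗ.[ℂ] H where
  domain :=
    { carrier := {x | Summable fun n => (α n : ℂ) • Q n x}
      zero_mem' := by simp [summable_zero]
      add_mem' := by
        intro x y hx hy
        simpa only [Set.mem_ofPred_eq, map_add, smul_add] using Summable.add hx hy
      smul_mem' := by
        intro c x hx
        have h := Summable.const_smul c (show Summable fun n => (α n : ℂ) • Q n x from hx)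
        simpa only [Set.mem_ofPred_eq, map_smul, smul_comm c] using h }
  toFun :=
    { toFun := fun x => ∑' n, (α n : ℂ) • Q n (x : H)
      map_add' := by
        intro x y
        have hx : Summable fun n => (α n : ℂ) • Q n (x : H) := x.2
        have hy : Summable fun n => (α n : ℂ) • Q n (y : H) := y.2
        simp only [Submodule.coe_add, map_add, smul_add]
        exact hx.tsum_add hy
      map_smul' := by
        intro c x
        have hx : Summable fun n => (α n : ℂ) • Q n (x : H) := x.2
        simp only [Submodule.coe_smul, map_smul, RingHom.id_apply]
        rw [← hx.tsum_const_smul c]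
        exact tsum_congr fun n => smul_comm _ _ _ }

/-- `‖[D, T]‖ ≤ C`: the bounded operator `T` maps the domain of `D` into itself, and `D T - T D` is
bounded by `C` there (so that, `D` being densely defined, `[D, T]` extends to a bounded operator on
`H` of norm at most `C`). -/
def CommutatorBound (D : H →ₗ.[ℂ] H) (T : H →L[ℂ] H) (C : ℝ) : Prop :=
  ∃ h : ∀ x ∈ D.domain, T x ∈ D.domain,
    ∀ (x : H) (hx : x ∈ D.domain), ‖D ⟨T x, h x hx⟩ - T (D ⟨x, hx⟩)‖ ≤ C * ‖x‖

/-- The bounded operator `R` is `(I + D²)⁻¹`: it maps `H` into the domain of `D²`, and it is a right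
and left inverse of `I + D²`. -/
def IsInverseOneAddSq (D : H →ₗ.[ℂ] H) (R : H →L[ℂ] H) : Prop :=
  (∀ x : H, ∃ (h : R x ∈ D.domain) (h' : D ⟨R x, h⟩ ∈ D.domain),
    R x + D ⟨D ⟨R x, h⟩, h'⟩ = x) ∧
  ∀ (x : H) (h : x ∈ D.domain) (h' : D ⟨x, h⟩ ∈ D.domain), R (x + D ⟨D ⟨x, h⟩, h'⟩) = x

/-- `p`-summability, `trace ((I + D²)^(-p/2)) < ∞`, for self-adjoint `D` and `p > 0`. The operator
`(I + D²)^(-p/2)` is the power `R^(p/2)` of `R = (I + D²)⁻¹`, formed by the continuous functional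
calculus; it is positive, so its trace is the sum of its diagonal entries in an orthonormal basis
and does not depend on the basis. -/
def IsPSummable [CompleteSpace H] (D : H →ₗ.[ℂ] H) (p : ℝ) : Prop :=
  ∃ R : H →L[ℂ] H, IsInverseOneAddSq D R ∧
    ∃ (w : Set H) (b : HilbertBasis w ℂ H),
      Summable fun i : w => (inner ℂ (b i) (cfc (fun t : ℝ => t ^ (p / 2)) R (b i))).re

end Operators

section Dirac

variable {A H : Type*} [CStarAlgebra A] [NormedAddCommGroup H] [InnerProductSpace ℂ H]
  [CompleteSpace H]

/-- The pair `(H, D)` is an unbounded Fredholm module over `A`, with `A` acting on `H` by `π`. -/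
structure IsUnboundedFredholmModule (π : A →⋆ₐ[ℂ] (H →L[ℂ] H)) (D : H →ₗ.[ℂ] H) : Prop where
  dense_domain : Dense (D.domain : Set H)
  selfAdjoint : IsSelfAdjoint D
  dense_bounded_commutator : Dense {a : A | ∃ C : ℝ, CommutatorBound D (π a) C}
  compact_resolvent : ∃ R : H →L[ℂ] H, IsInverseOneAddSq D R ∧ IsCompactOperator R

/-- The set of all self-adjoint `a` in `A` with `‖[D, a]‖ ≤ 1`. -/
def lipschitzBall (π : A →⋆ₐ[ℂ] (H →L[ℂ] H)) (D : H →ₗ.[ℂ] H) : Set A :=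
  {a | IsSelfAdjoint a ∧ CommutatorBound D (π a) 1}

/-- A set `S` of elements of `A` separates the states. -/
def SeparatesStates (S : Set A) : Prop :=
  ∀ φ ∈ StateSpace A, ∀ ψ ∈ StateSpace A, (∀ a ∈ S, φ a = ψ a) → φ = ψ

/-- The image of `S` in `A / ℂ 1` is precompact (totally bounded) for the quotient norm. -/
def PrecompactModScalars (S : Set A) : Prop :=
  TotallyBounded ((Submodule.span ℂ {(1 : A)}).mkQ '' S)

/-- `d(φ, ψ) = sup {|φ(a) - ψ(a)| : a ∈ S}` is finite and is a metric on the state space, and the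
topology of this metric is the weak*-topology. -/
def InducesWeakStarMetric (S : Set A) : Prop :=
  ∃ m : MetricSpace (StateSpace A),
    (∀ φ ψ : StateSpace A,
      IsLUB {r : ℝ | ∃ a ∈ S, r = ‖(φ : WeakDual ℂ A) a - (ψ : WeakDual ℂ A) a‖}
        (m.dist φ ψ)) ∧
    m.toUniformSpace.toTopologicalSpace =
      (instTopologicalSpaceSubtype : TopologicalSpace (StateSpace A))

/-- The operator `D = ∑ α_n Q_n`. -/
def diracOperator (π : A →⋆ₐ[ℂ] (H →L[ℂ] H)) (ξ : H) (𝒜 : AFSequence A) (α : ℕ → ℝ) :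
    H →ₗ.[ℂ] H :=
  diagonalOperator (differenceProj π ξ 𝒜) α

/-- The properties required of the sequence `α` of eigenvalues. -/
structure IsDiracSequence (π : A →⋆ₐ[ℂ] (H →L[ℂ] H)) (ξ : H) (𝒜 : AFSequence A) (α : ℕ → ℝ) :
    Prop where
  zero : α 0 = 0
  pos : ∀ n, 1 ≤ n → 0 < α n
  /-- The eigenspaces of `D` are the spaces `F_n`. -/
  eigenspace : ∀ (n : ℕ) (x : H), x ∈ differenceSpace π ξ 𝒜 n ↔
    ∃ h : x ∈ (diracOperator π ξ 𝒜 α).domain, diracOperator π ξ 𝒜 α ⟨x, h⟩ = (α n : ℂ) • x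
  unbounded : ¬ ∃ C : ℝ, ∀ x : (diracOperator π ξ 𝒜 α).domain,
    ‖diracOperator π ξ 𝒜 α x‖ ≤ C * ‖(x : H)‖
  fredholm : IsUnboundedFredholmModule π (diracOperator π ξ 𝒜 α)
  separates : SeparatesStates (lipschitzBall π (diracOperator π ξ 𝒜 α))
  precompact : PrecompactModScalars (lipschitzBall π (diracOperator π ξ 𝒜 α))
  metric : InducesWeakStarMetric (lipschitzBall π (diracOperator π ξ 𝒜 α))

end Dirac

end

/-! The operator `D` controls elements of `A` through the vector `ξ`. Since `ξ = 1ξ` lies in `F_0`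
and `α 0 = 0`, we have `Dξ = 0`, so a commutator bound `‖[D, a]‖ ≤ 1` gives `‖D a ξ‖ ≤ 1` and hence
`α n * ‖Q_n a ξ‖ ≤ 1` for all `n` (`norm_differenceProj_apply_le`). Now `Q_n a ξ = b_n ξ` with `b_n
∈ A_n`. As `ξ` is separating and `A_n` is finite-dimensional, `‖b‖ ≤ c_n ‖b ξ‖` on `A_n`. If `α n ≥
2 ^ n * c_n`, then `‖b_n‖ ≤ 2⁻ⁿ` for `n ≥ 1`, the series of the `b_n` converges in norm, and its sum
is `a` because `ξ` separates. The term `b_0` is a scalar, so modulo scalars the Lipschitz ball lies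
in a continuous image of a product of compact balls (`precompactModScalars_lipschitzBall`).

Conversely, an element of `A_m` commutes with `Q_n` for `n > m`, so its commutator with `D` is a
finite sum, bounded for every choice of `α`. Thus the Lipschitz ball has dense span
(`dense_span_lipschitzBall`). For any set containing 0, precompactness modulo scalars and dense span
suffice for the metric to exist and to give the weak*-topology
(`inducesWeakStarMetric_of_dense_span`).

The rest is growth of `α`: strict monotonicity makes the eigenvalues distinct, `α n ≥ 2 ^ n` gives
the compact resolvent and, as infinitely many `F_n` are nonzero, unboundedness; `α n ^ p ≥ 2 ^ n *
dim F_n` gives the finite trace. -/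

section States

/-! ### States, and metrics on the state space -/

variable {A : Type*} [CStarAlgebra A]

theorem StateSpace.map_nonneg_of_nonneg [PartialOrder A] [StarOrderedRing A] {φ : WeakDual ℂ A}
    (hφ : φ ∈ StateSpace A) {a : A} (ha : 0 ≤ a) : 0 ≤ φ a := by
  obtain ⟨b, rfl⟩ := CStarAlgebra.nonneg_iff_eq_star_mul_self.1 ha
  exact hφ.1 b

theorem StateSpace.norm_apply_le_of_isSelfAdjoint {φ : WeakDual ℂ A} (hφ : φ ∈ StateSpace A)
    {a : A} (ha : IsSelfAdjoint a) : ‖φ a‖ ≤ ‖a‖ := by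
  let : PartialOrder A := CStarAlgebra.spectralOrder A
  have : StarOrderedRing A := CStarAlgebra.spectralOrderedRing A
  have key : φ (algebraMap ℝ A ‖a‖) = (‖a‖ : ℂ) := by
    have : algebraMap ℝ A ‖a‖ = (‖a‖ : ℂ) • (1 : A) := by
      rw [Algebra.algebraMap_eq_smul_one, Complex.coe_smul]
    rw [this, map_smul, hφ.2, smul_eq_mul, mul_one]
  have h1 := StateSpace.map_nonneg_of_nonneg hφ (sub_nonneg.2 ha.le_algebraMap_norm_self)
  have h2 := StateSpace.map_nonneg_of_nonneg hφ (sub_nonneg.2 ha.neg_algebraMap_norm_le_self)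
  rw [map_sub, key, Complex.le_def] at h1
  rw [map_sub, map_neg, key, Complex.le_def] at h2
  simp only [Complex.zero_re, Complex.zero_im, Complex.sub_re, Complex.sub_im, Complex.neg_re,
    Complex.neg_im, Complex.ofReal_re, Complex.ofReal_im] at h1 h2
  have him : (φ a).im = 0 := by linarith [h1.2]
  have : φ a = ((φ a).re : ℂ) := Complex.ext rfl (by simp [him])
  rw [this, Complex.norm_real, Real.norm_eq_abs, abs_le]
  constructor <;> linarith [h1.1, h2.1]

/-- Splitting into real and imaginary parts costs a factor 2, which is harmless here. -/
theorem StateSpace.norm_apply_le {φ : WeakDual ℂ A} (hφ : φ ∈ StateSpace A) (a : A) :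
    ‖φ a‖ ≤ 2 * ‖a‖ := by
  have h : φ a = φ (realPart a : A) + Complex.I * φ (imaginaryPart a : A) := by
    conv_lhs => rw [← realPart_add_I_smul_imaginaryPart a]
    rw [map_add, map_smul, smul_eq_mul]
  have h1 := (StateSpace.norm_apply_le_of_isSelfAdjoint hφ (realPart a).2).trans
    (realPart.norm_le a)
  have h2 := (StateSpace.norm_apply_le_of_isSelfAdjoint hφ (imaginaryPart a).2).trans
    (imaginaryPart.norm_le a)
  rw [h]
  refine (norm_add_le _ _).trans ?_
  rw [norm_mul, Complex.norm_I, one_mul]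
  linarith

theorem StateSpace.norm_sub_apply_le {φ ψ : WeakDual ℂ A} (hφ : φ ∈ StateSpace A)
    (hψ : ψ ∈ StateSpace A) (a : A) : ‖φ a - ψ a‖ ≤ 4 * ‖a‖ := by
  refine (norm_sub_le _ _).trans ?_
  linarith [StateSpace.norm_apply_le hφ a, StateSpace.norm_apply_le hψ a]

theorem separatesStates_of_dense_span {S : Set A} (hS : Dense (Submodule.span ℂ S : Set A)) :
    SeparatesStates S := by
  intro φ _ ψ _ h
  have h' : Set.EqOn φ ψ (Submodule.span ℂ S) := by
    intro a ha
    induction ha using Submodule.span_induction with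
    | mem x hx => exact h x hx
    | zero => simp
    | add x y _ _ hx hy => rw [map_add, map_add, hx, hy]
    | smul c x _ hx => rw [map_smul, map_smul, hx]
  exact DFunLike.coe_injective (Continuous.ext_on hS φ.continuous ψ.continuous h')

/-- A set that is precompact modulo scalars is, as a set of functions on pairs of states, within
any given distance of a finite set. -/
theorem PrecompactModScalars.exists_finite_approx {S : Set A} (hS : PrecompactModScalars S)
    {ε : ℝ} (hε : 0 < ε) :
    ∃ t : Set A, t.Finite ∧ ∀ a ∈ S, ∃ b ∈ t, ∀ φ ∈ StateSpace A, ∀ ψ ∈ StateSpace A,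
      ‖(φ a - ψ a) - (φ b - ψ b)‖ ≤ ε := by
  obtain ⟨t, ht, hcov⟩ := Metric.totallyBounded_iff.1 hS (ε / 4) (by positivity)
  refine ⟨Quotient.out '' t, ht.image _, fun a ha => ?_⟩
  have := hcov (Set.mem_image_of_mem _ ha)
  simp only [Set.mem_iUnion, Metric.mem_ball, exists_prop] at this
  obtain ⟨q, hq, hd⟩ := this
  refine ⟨_, Set.mem_image_of_mem _ hq, fun φ hφ ψ hψ => ?_⟩
  set b : A := Quotient.out q
  have hb : (Submodule.span ℂ {(1 : A)}).mkQ b = q := Quotient.out_eq q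
  rw [← hb, dist_eq_norm, ← map_sub] at hd
  -- The class of `a - b` has a representative `c` of norm below `ε / 4`. It differs from `a - b` by
  -- a scalar, which `φ - ψ` kills, and `‖φ c - ψ c‖ ≤ 4 * ‖c‖`.
  obtain ⟨c, hc, hlt⟩ := Submodule.Quotient.norm_mk_lt (S := Submodule.span ℂ {(1 : A)})
    ((Submodule.span ℂ {(1 : A)}).mkQ (a - b))
    (ε := ε / 4 - ‖(Submodule.span ℂ {(1 : A)}).mkQ (a - b)‖) (by linarith)
  have hmem : c - (a - b) ∈ Submodule.span ℂ {(1 : A)} := (Submodule.Quotient.eq _).1 hc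
  obtain ⟨z, hz⟩ := Submodule.mem_span_singleton.1 hmem
  have hcz : a - b = c - z • 1 := by rw [hz]; abel
  have : (φ a - ψ a) - (φ b - ψ b) = φ c - ψ c := by
    have h1 : φ a - φ b = φ c - z := by
      rw [← map_sub, hcz, map_sub, map_smul, hφ.2, smul_eq_mul, mul_one]
    have h2 : ψ a - ψ b = ψ c - z := by
      rw [← map_sub, hcz, map_sub, map_smul, hψ.2, smul_eq_mul, mul_one]
    linear_combination h1 - h2
  rw [this]
  refine (StateSpace.norm_sub_apply_le hφ hψ c).trans ?_
  linarith

theorem PrecompactModScalars.bddAbove {S : Set A} (hS : PrecompactModScalars S)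
    {φ ψ : WeakDual ℂ A} (hφ : φ ∈ StateSpace A) (hψ : ψ ∈ StateSpace A) :
    BddAbove {r : ℝ | ∃ a ∈ S, r = ‖φ a - ψ a‖} := by
  obtain ⟨t, ht, h⟩ := hS.exists_finite_approx one_pos
  obtain ⟨M, hM⟩ := (ht.image fun b => ‖φ b - ψ b‖).bddAbove
  refine ⟨M + 1, ?_⟩
  rintro r ⟨a, ha, rfl⟩
  obtain ⟨b, hb, hab⟩ := h a ha
  have h1 : ‖φ b - ψ b‖ ≤ M := hM (Set.mem_image_of_mem _ hb)
  have h2 := norm_le_norm_add_norm_sub' (φ a - ψ a) (φ b - ψ b)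
  linarith [hab φ hφ ψ hψ]

/-- A set precompact modulo scalars, with dense linear span, induces the weak*-topology on the
state space. -/
theorem inducesWeakStarMetric_of_dense_span {S : Set A} (h0 : (0 : A) ∈ S)
    (hpre : PrecompactModScalars S) (hspan : Dense (Submodule.span ℂ S : Set A)) :
    InducesWeakStarMetric S := by
  let V (φ ψ : StateSpace A) : Set ℝ :=
    {r : ℝ | ∃ a ∈ S, r = ‖(φ : WeakDual ℂ A) a - (ψ : WeakDual ℂ A) a‖}
  have hV0 : ∀ φ ψ, 0 ∈ V φ ψ := fun φ ψ => ⟨0, h0, by simp⟩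
  have hlub : ∀ φ ψ, IsLUB (V φ ψ) (sSup (V φ ψ)) := fun φ ψ =>
    isLUB_csSup ⟨0, hV0 φ ψ⟩ (hpre.bddAbove φ.2 ψ.2)
  have hle : ∀ φ ψ : StateSpace A, ∀ a ∈ S,
      ‖(φ : WeakDual ℂ A) a - (ψ : WeakDual ℂ A) a‖ ≤ sSup (V φ ψ) := fun φ ψ a ha =>
    (hlub φ ψ).1 ⟨a, ha, rfl⟩
  let m : MetricSpace (StateSpace A) :=
    { dist := fun φ ψ => sSup (V φ ψ)
      dist_self := fun φ => by
        have : V φ φ = {0} := by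
          ext r
          constructor
          · rintro ⟨a, _, rfl⟩; simp
          · rintro rfl; exact hV0 _ _
        rw [this, csSup_singleton]
      dist_comm := fun φ ψ => by
        have : V φ ψ = V ψ φ := by
          ext r
          simp only [V, Set.mem_ofPred_eq, norm_sub_rev]
        rw [this]
      dist_triangle := fun φ ψ χ => by
        refine (hlub φ χ).2 ?_
        rintro r ⟨a, ha, rfl⟩
        exact (norm_sub_le_norm_sub_add_norm_sub _ ((ψ : WeakDual ℂ A) a) _).trans
          (add_le_add (hle φ ψ a ha) (hle ψ χ a ha))
      eq_of_dist_eq_zero := fun {φ ψ} h => by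
        refine Subtype.ext (separatesStates_of_dense_span hspan φ φ.2 ψ ψ.2 fun a ha => ?_)
        rw [← sub_eq_zero, ← norm_le_zero_iff]
        exact (hle φ ψ a ha).trans h.le }
  refine ⟨m, hlub, ?_⟩
  refine TopologicalSpace.ext_nhds fun φ => ?_
  refine le_antisymm ?_ ?_
  · -- the evaluations are continuous for the metric
    have hcont : ∀ a : A, @Continuous _ _ m.toUniformSpace.toTopologicalSpace _
        fun χ : StateSpace A => (χ : WeakDual ℂ A) a := by
      let := m
      -- Elements of the span are Lipschitz functions on the state space; density then gives
      -- continuity of every evaluation, as a uniform limit.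
      have hspanC : ∀ a ∈ Submodule.span ℂ S, ∃ C : ℝ, ∀ φ ψ : StateSpace A,
          ‖(φ : WeakDual ℂ A) a - (ψ : WeakDual ℂ A) a‖ ≤ C * dist φ ψ := by
        intro a ha
        induction ha using Submodule.span_induction with
        | mem x hx => exact ⟨1, fun φ ψ => by rw [one_mul]; exact hle φ ψ x hx⟩
        | zero => exact ⟨0, fun φ ψ => by simp⟩
        | add x y _ _ hx hy =>
          obtain ⟨C, hC⟩ := hx
          obtain ⟨C', hC'⟩ := hy
          refine ⟨C + C', fun φ ψ => ?_⟩
          rw [map_add, map_add, add_sub_add_comm, add_mul]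
          exact (norm_add_le _ _).trans (add_le_add (hC φ ψ) (hC' φ ψ))
        | smul c x _ hx =>
          obtain ⟨C, hC⟩ := hx
          refine ⟨‖c‖ * C, fun φ ψ => ?_⟩
          rw [map_smul, map_smul, ← smul_sub, norm_smul, mul_assoc]
          exact mul_le_mul_of_nonneg_left (hC φ ψ) (norm_nonneg c)
      intro a
      refine Metric.continuous_iff.2 fun ψ ε hε => ?_
      obtain ⟨b, hb, hab⟩ := hspan.exists_dist_lt a (ε := ε / 8) (by positivity)
      obtain ⟨C, hC⟩ := hspanC b hb
      refine ⟨ε / (2 * (|C| + 1)), by positivity, fun χ hχ => ?_⟩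
      rw [dist_eq_norm] at hab ⊢
      have h1 := StateSpace.norm_sub_apply_le χ.2 ψ.2 (a - b)
      have h2 : C * dist χ ψ ≤ (|C| + 1) * dist χ ψ :=
        mul_le_mul_of_nonneg_right (by linarith [le_abs_self C]) dist_nonneg
      have h3 : (|C| + 1) * dist χ ψ < ε / 2 := by
        rw [lt_div_iff₀ (by positivity)] at hχ
        linarith
      have h4 : (χ : WeakDual ℂ A) a - (ψ : WeakDual ℂ A) a =
          ((χ : WeakDual ℂ A) (a - b) - (ψ : WeakDual ℂ A) (a - b)) +
            ((χ : WeakDual ℂ A) b - (ψ : WeakDual ℂ A) b) := by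
        rw [map_sub, map_sub]; ring
      rw [h4]
      refine (norm_add_le _ _).trans_lt ?_
      linarith [hC χ ψ]
    have : @Continuous _ _ m.toUniformSpace.toTopologicalSpace instTopologicalSpaceSubtype
        (id : StateSpace A → StateSpace A) := by
      refine continuous_induced_rng.2 ?_
      let := m.toUniformSpace.toTopologicalSpace
      exact WeakDual.continuous_of_continuous_eval hcont
    exact @Continuous.tendsto _ _ m.toUniformSpace.toTopologicalSpace instTopologicalSpaceSubtype
      _ this φ
  -- Conversely, a metric ball is a weak*-neighbourhood: by precompactness, finitely many
  -- evaluations control all of `S` up to `ε / 3`. The resulting bound `2 * ε / 3` keeps the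
  -- supremum strictly below `ε`.
  · rw [(@Metric.nhds_basis_ball _ m.toPseudoMetricSpace φ).ge_iff]
    intro ε hε
    obtain ⟨t, ht, h⟩ := hpre.exists_finite_approx (ε := ε / 3) (by positivity)
    have hev : ∀ᶠ χ : StateSpace A in @nhds (StateSpace A) instTopologicalSpaceSubtype φ, ∀ b ∈ t,
        ‖(χ : WeakDual ℂ A) b - (φ : WeakDual ℂ A) b‖ < ε / 3 := by
      rw [Filter.eventually_all_finite ht]
      intro b _
      have hc : Continuous fun χ : StateSpace A =>
          ‖(χ : WeakDual ℂ A) b - (φ : WeakDual ℂ A) b‖ :=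
        (((WeakDual.eval_continuous b).comp continuous_subtype_val).sub continuous_const).norm
      refine hc.tendsto φ |>.eventually_lt_const ?_
      simpa using by positivity
    filter_upwards [hev] with χ hχ
    suffices hub : 2 * ε / 3 ∈ upperBounds (V χ φ) from
      ((hlub χ φ).2 hub).trans_lt (by linarith)
    rintro r ⟨a, ha, rfl⟩
    obtain ⟨b, hb, hab⟩ := h a ha
    have h1 := hab χ χ.2 φ φ.2
    have h2 := hχ b hb
    have h3 := norm_le_norm_add_norm_sub' ((χ : WeakDual ℂ A) a - (φ : WeakDual ℂ A) a)
      ((χ : WeakDual ℂ A) b - (φ : WeakDual ℂ A) b)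
    linarith

end States

/-! ### Diagonal operators for a resolution of the identity -/

section ProjectionResolution

variable {H : Type*} [NormedAddCommGroup H] [InnerProductSpace ℂ H]

/-- The `Q n` are mutually orthogonal projections with strong sum the identity. -/
structure IsProjectionResolution (Q : ℕ → (H →L[ℂ] H)) : Prop where
  inner_left : ∀ n x y, inner ℂ (Q n x) y = inner ℂ x (Q n y)
  idem : ∀ n x, Q n (Q n x) = Q n x
  ortho : ∀ n m, n ≠ m → ∀ x, Q n (Q m x) = 0
  hasSum : ∀ x, HasSum (fun n => Q n x) x

theorem OrthogonalFamily.isProjectionResolution [CompleteSpace H] {F : ℕ → Submodule ℂ H}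
    [∀ n, FiniteDimensional ℂ (F n)]
    (hF : OrthogonalFamily ℂ (fun n => F n) fun n => (F n).subtypeₗᵢ)
    (htot : ⊤ ≤ (⨆ n, F n).topologicalClosure) :
    IsProjectionResolution fun n => (F n).starProjection := by
  have hortho : ∀ n m, n ≠ m → ∀ x ∈ F m, (F n).starProjection x = 0 := by
    intro n m hnm x hx
    rw [Submodule.starProjection_apply_eq_zero_iff]
    intro y hy
    exact hF hnm ⟨y, hy⟩ ⟨x, hx⟩
  refine ⟨fun n x y => (F n).inner_starProjection_left_eq_right x y, fun n x => ?_,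
    fun n m hnm x => ?_, fun x => ?_⟩
  · exact Submodule.starProjection_eq_self_iff.2 (Submodule.starProjection_apply_mem _ _)
  · exact hortho n m hnm _ (Submodule.starProjection_apply_mem _ _)
  · have hS := IsHilbertSum.mkInternal (F := F) hF htot
    have hw := hS.hasSum_linearIsometryEquiv_symm (hS.linearIsometryEquiv x)
    rw [LinearIsometryEquiv.symm_apply_apply] at hw
    convert hw using 2 with n
    have h1 := hw.mapL (F n).starProjection
    have h2 := hasSum_single (f := fun m => (F n).starProjection
      ((F m).subtypeₗᵢ (hS.linearIsometryEquiv x m))) n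
      (fun m hm => hortho n m hm.symm _ (hS.linearIsometryEquiv x m).2)
    rw [h1.unique h2]
    exact Submodule.starProjection_eq_self_iff.2 (hS.linearIsometryEquiv x n).2

namespace IsProjectionResolution

variable {Q : ℕ → (H →L[ℂ] H)} (hQ : IsProjectionResolution Q)
include hQ

theorem norm_le (n : ℕ) (x : H) : ‖Q n x‖ ≤ ‖x‖ := by
  have h : inner ℂ (Q n x) (Q n x) = inner ℂ x (Q n x) := by rw [hQ.inner_left, hQ.idem]
  have h2 : ‖Q n x‖ * ‖Q n x‖ ≤ ‖x‖ * ‖Q n x‖ := by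
    rw [← inner_self_eq_norm_mul_norm (𝕜 := ℂ), h]
    exact re_inner_le_norm _ _
  rcases (norm_nonneg (Q n x)).eq_or_lt with h0 | h0
  · rw [← h0]; exact norm_nonneg x
  · exact le_of_mul_le_mul_right h2 h0

theorem opNorm_le (n : ℕ) : ‖Q n‖ ≤ 1 :=
  ContinuousLinearMap.opNorm_le_bound _ zero_le_one fun x => by rw [one_mul]; exact hQ.norm_le n x

theorem ext_proj {x y : H} (h : ∀ n, Q n x = Q n y) : x = y :=
  (hQ.hasSum x).unique (by simpa only [h] using hQ.hasSum y)

theorem proj_of_hasSum {c : ℕ → ℂ} {x y : H} (h : HasSum (fun n => c n • Q n x) y) (m : ℕ) :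
    Q m y = c m • Q m x := by
  have h1 := h.mapL (Q m)
  have h2 := hasSum_single (f := fun n => Q m (c n • Q n x)) m
    (fun n hn => by rw [map_smul, hQ.ortho m n hn.symm, smul_zero])
  rw [h1.unique h2, map_smul, hQ.idem]

theorem proj_diagonalOperator (α : ℕ → ℝ) (x : (diagonalOperator Q α).domain) (m : ℕ) :
    Q m (diagonalOperator Q α x) = (α m : ℂ) • Q m (x : H) :=
  hQ.proj_of_hasSum (Summable.hasSum (f := fun n => (α n : ℂ) • Q n (x : H)) x.2) m

/-- Since `y` is the sum of its components, the existence of `y` already is the domain condition for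
`x`. Together with `proj_diagonalOperator`, this reduces statements about `D` to components. -/
theorem exists_diagonalOperator_eq {α : ℕ → ℝ} {x y : H}
    (h : ∀ n, Q n y = (α n : ℂ) • Q n x) :
    ∃ hx : x ∈ (diagonalOperator Q α).domain, diagonalOperator Q α ⟨x, hx⟩ = y := by
  have hs : HasSum (fun n => (α n : ℂ) • Q n x) y := by simpa only [h] using hQ.hasSum y
  exact ⟨hs.summable, hs.tsum_eq⟩

theorem exists_diagonalOperator_proj_eq (α : ℕ → ℝ) (n : ℕ) (x : H) :
    ∃ hx : Q n x ∈ (diagonalOperator Q α).domain,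
      diagonalOperator Q α ⟨Q n x, hx⟩ = (α n : ℂ) • Q n x := by
  refine hQ.exists_diagonalOperator_eq fun m => ?_
  by_cases h : m = n
  · subst h; rw [map_smul]
  · rw [map_smul, hQ.ortho m n h, smul_zero, smul_zero]

theorem exists_diagonalOperator_eq_smul_iff {α : ℕ → ℝ} (hα : Function.Injective α) (n : ℕ)
    (x : H) :
    (∃ hx : x ∈ (diagonalOperator Q α).domain, diagonalOperator Q α ⟨x, hx⟩ = (α n : ℂ) • x) ↔
      Q n x = x := by
  constructor
  · rintro ⟨hx, h⟩
    refine hQ.ext_proj fun m => ?_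
    by_cases hmn : m = n
    · subst hmn; exact hQ.idem m x
    · have h1 := hQ.proj_diagonalOperator α ⟨x, hx⟩ m
      rw [h, map_smul] at h1
      have hne : (α n : ℂ) - α m ≠ 0 := by
        rw [sub_ne_zero]
        exact fun h => hmn (hα (Complex.ofReal_injective h)).symm
      have h2 : ((α n : ℂ) - α m) • Q m x = 0 := by rw [sub_smul, h1, sub_self]
      rw [hQ.ortho m n hmn, (smul_eq_zero.1 h2).resolve_left hne]
  · intro h
    have := hQ.exists_diagonalOperator_proj_eq α n x
    rwa [h] at this

theorem dense_domain (α : ℕ → ℝ) : Dense ((diagonalOperator Q α).domain : Set H) := fun x =>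
  mem_closure_of_tendsto (hQ.hasSum x) <| Filter.Eventually.of_forall fun _ =>
    Submodule.sum_mem _ fun n _ => (hQ.exists_diagonalOperator_proj_eq α n x).1

theorem inner_diagonalOperator (α : ℕ → ℝ) (x y : (diagonalOperator Q α).domain) :
    inner ℂ (diagonalOperator Q α x) (y : H) = inner ℂ (x : H) (diagonalOperator Q α y) := by
  have hx : HasSum (fun n => inner ℂ (y : H) ((α n : ℂ) • Q n (x : H)))
      (inner ℂ (y : H) (diagonalOperator Q α x)) :=
    (Summable.hasSum (f := fun n => (α n : ℂ) • Q n (x : H)) x.2).mapL (innerSL ℂ (y : H))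
  have hy : HasSum (fun n => inner ℂ (x : H) ((α n : ℂ) • Q n (y : H)))
      (inner ℂ (x : H) (diagonalOperator Q α y)) :=
    (Summable.hasSum (f := fun n => (α n : ℂ) • Q n (y : H)) y.2).mapL (innerSL ℂ (x : H))
  have hx' := Complex.hasSum_conj'.2 hx
  rw [inner_conj_symm] at hx'
  refine hx'.unique ?_
  convert hy using 2 with n
  rw [inner_smul_right, inner_smul_right, map_mul, Complex.conj_ofReal, inner_conj_symm,
    hQ.inner_left]

/-- Symmetry gives `D ≤ D.adjoint`. For `y` in the adjoint's domain, testing against the vectors `Q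
n v` shows that `D.adjoint y` has components `α n • Q n y`, so `y` is in the domain of `D`. -/
theorem isSelfAdjoint_diagonalOperator [CompleteSpace H] (α : ℕ → ℝ) :
    IsSelfAdjoint (diagonalOperator Q α) := by
  rw [LinearPMap.isSelfAdjoint_def]
  set D := diagonalOperator Q α
  have hle : D ≤ D.adjoint := LinearPMap.IsFormalAdjoint.le_adjoint (hQ.dense_domain α)
    fun x y => hQ.inner_diagonalOperator α x y
  refine (LinearPMap.eq_of_le_of_domain_eq hle (le_antisymm hle.1 fun y hy => ?_)).symm
  refine (hQ.exists_diagonalOperator_eq (α := α) (y := D.adjoint ⟨y, hy⟩) fun n => ?_).1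
  refine ext_inner_right ℂ fun v => ?_
  obtain ⟨hv, hDv⟩ := hQ.exists_diagonalOperator_proj_eq α n v
  have := LinearPMap.adjoint_isFormalAdjoint (T := D) (hQ.dense_domain α) ⟨y, hy⟩ ⟨Q n v, hv⟩
  rw [hDv] at this
  rw [hQ.inner_left, this, inner_smul_left, inner_smul_right, Complex.conj_ofReal, hQ.inner_left]

section BoundedDiagonal

variable [CompleteSpace H] {c : ℕ → ℝ} (hc : Summable fun n => |c n|)
include hc

theorem summable_smul : Summable fun n => (c n : ℂ) • Q n := by
  refine Summable.of_norm_bounded hc fun n => ?_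
  rw [norm_smul, Complex.norm_real, Real.norm_eq_abs]
  exact mul_le_of_le_one_right (abs_nonneg _) (hQ.opNorm_le n)

theorem proj_tsum_smul (x : H) (n : ℕ) : Q n ((∑' n, (c n : ℂ) • Q n) x) = (c n : ℂ) • Q n x :=
  hQ.proj_of_hasSum ((hQ.summable_smul hc).hasSum.mapL
    (ContinuousLinearMap.apply ℂ H x)) n

theorem tsum_smul_apply_of_proj_eq {x : H} {n : ℕ} (h : Q n x = x) :
    (∑' n, (c n : ℂ) • Q n) x = (c n : ℂ) • x := by
  refine hQ.ext_proj fun m => ?_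
  rw [hQ.proj_tsum_smul hc, map_smul]
  by_cases hmn : m = n
  · rw [hmn]
  · rw [← h, hQ.ortho m n hmn, smul_zero, smul_zero]

omit hc in
theorem isSelfAdjoint_tsum_smul : IsSelfAdjoint (∑' n, (c n : ℂ) • Q n) := by
  have hs : ∀ n, IsSelfAdjoint ((c n : ℂ) • Q n) := fun n => by
    refine IsSelfAdjoint.smul (Complex.conj_ofReal _) ?_
    rw [ContinuousLinearMap.isSelfAdjoint_iff_isSymmetric]
    exact fun x y => hQ.inner_left n x y
  rw [IsSelfAdjoint, tsum_star]
  exact tsum_congr fun n => (hs n).star_eq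

theorem isCompactOperator_tsum_smul (hcomp : ∀ n, IsCompactOperator (Q n)) :
    IsCompactOperator (∑' n, (c n : ℂ) • Q n : H →L[ℂ] H) := by
  refine isCompactOperator_of_tendsto (hQ.summable_smul hc).hasSum
    (Filter.Eventually.of_forall fun s => ?_)
  exact Submodule.sum_mem (compactOperator (RingHom.id ℂ) H H) fun n _ =>
    Submodule.smul_mem (compactOperator (RingHom.id ℂ) H H) _ (hcomp n)

end BoundedDiagonal

theorem isInverseOneAddSq_diagonalOperator [CompleteSpace H] {α : ℕ → ℝ}
    (hc : Summable fun n => |(1 + α n ^ 2)⁻¹|)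
    (hc' : Summable fun n => |α n * (1 + α n ^ 2)⁻¹|) :
    IsInverseOneAddSq (diagonalOperator Q α) (∑' n, (((1 + α n ^ 2)⁻¹ : ℝ) : ℂ) • Q n) := by
  have hne : ∀ n, (1 + (α n : ℂ) ^ 2) ≠ 0 := fun n => by
    exact_mod_cast (show (1 + α n ^ 2 : ℝ) ≠ 0 by positivity)
  set R : H →L[ℂ] H := ∑' n, (((1 + α n ^ 2)⁻¹ : ℝ) : ℂ) • Q n
  have hR : ∀ x n, Q n (R x) = (1 + (α n : ℂ) ^ 2)⁻¹ • Q n x := fun x n => by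
    rw [hQ.proj_tsum_smul hc]; push_cast; rfl
  constructor
  · intro x
    have hs : Summable fun n => (α n : ℂ) • Q n (R x) := by
      have := hQ.summable_smul hc'
      convert ((this.hasSum.mapL (ContinuousLinearMap.apply ℂ H x))).summable using 2 with n
      rw [hR, smul_smul]
      simp
    refine ⟨hs, ?_⟩
    -- Componentwise this is `1 - (1 + α²)⁻¹ = α * (α * (1 + α²)⁻¹)`; it puts `D R x` in the domain
    -- and computes its image at once.
    have h1 : ∀ n, Q n (x - R x) = (α n : ℂ) • Q n (diagonalOperator Q α ⟨R x, hs⟩) := fun n => by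
      rw [hQ.proj_diagonalOperator, map_sub, hR, smul_smul, smul_smul]
      nth_rewrite 1 [← one_smul ℂ (Q n x)]
      rw [← sub_smul]
      congr 1
      field_simp [hne n]
      ring
    obtain ⟨h', h''⟩ := hQ.exists_diagonalOperator_eq h1
    exact ⟨h', by rw [h'']; abel⟩
  · intro x h h'
    refine hQ.ext_proj fun n => ?_
    rw [hR, map_add, hQ.proj_diagonalOperator, hQ.proj_diagonalOperator, smul_smul]
    nth_rewrite 1 [← one_smul ℂ (Q n x)]
    rw [← add_smul, smul_smul, ← sq, inv_mul_cancel₀ (hne n), one_smul]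

end IsProjectionResolution

end ProjectionResolution

/-! ### The filtration `H_n` and its differences `F_n` -/

theorem Submodule.starProjection_inf_orthogonal {H : Type*} [NormedAddCommGroup H]
    [InnerProductSpace ℂ H] {U V : Submodule ℂ H} [U.HasOrthogonalProjection]
    [V.HasOrthogonalProjection] [(V ⊓ Uᗮ).HasOrthogonalProjection] (h : U ≤ V) :
    (V ⊓ Uᗮ).starProjection = V.starProjection - U.starProjection := by
  ext x
  rw [sub_apply]
  refine Submodule.eq_starProjection_of_mem_orthogonal ⟨?_, ?_⟩ ?_
  · exact V.sub_mem (V.starProjection_apply_mem x) (h (U.starProjection_apply_mem x))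
  · have h1 := Submodule.sub_starProjection_mem_orthogonal (K := U) x
    have h2 := Submodule.orthogonal_le h (Submodule.sub_starProjection_mem_orthogonal (K := V) x)
    have h3 := Uᗮ.sub_mem h1 h2
    rwa [sub_sub_sub_cancel_left] at h3
  · have h1 := Submodule.orthogonal_le (inf_le_left : V ⊓ Uᗮ ≤ V)
      (Submodule.sub_starProjection_mem_orthogonal (K := V) x)
    have h2 := Submodule.orthogonal_le (inf_le_right : V ⊓ Uᗮ ≤ Uᗮ)
      (Submodule.le_orthogonal_orthogonal U (U.starProjection_apply_mem x))
    convert (V ⊓ Uᗮ)ᗮ.add_mem h1 h2 using 1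
    abel

section Filtration

variable {A H : Type*} [CStarAlgebra A] [NormedAddCommGroup H] [InnerProductSpace ℂ H]
  [CompleteSpace H] (π : A →⋆ₐ[ℂ] (H →L[ℂ] H)) (ξ : H) (𝒜 : AFSequence A)

instance instFiniteDimensionalDifferenceSpace (n : ℕ) :
    FiniteDimensional ℂ (differenceSpace π ξ 𝒜 n) := by
  cases n with
  | zero => exact inferInstanceAs (FiniteDimensional ℂ (filtrationSpace π ξ 𝒜 0))
  | succ n =>
    exact Submodule.finiteDimensional_of_le
      (S₁ := differenceSpace π ξ 𝒜 (n + 1)) (S₂ := filtrationSpace π ξ 𝒜 (n + 1)) inf_le_left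

variable {π ξ 𝒜}

theorem mem_filtrationSpace_iff {n : ℕ} {x : H} :
    x ∈ filtrationSpace π ξ 𝒜 n ↔ ∃ a ∈ 𝒜.alg n, π a ξ = x := Iff.rfl

variable (π ξ 𝒜)

theorem filtrationSpace_mono : Monotone (filtrationSpace π ξ 𝒜) := by
  rintro m n hmn _ ⟨a, ha, rfl⟩
  exact ⟨a, 𝒜.mono hmn ha, rfl⟩

theorem differenceSpace_le_filtrationSpace (n : ℕ) :
    differenceSpace π ξ 𝒜 n ≤ filtrationSpace π ξ 𝒜 n := by
  cases n with
  | zero => exact le_rfl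
  | succ n => exact inf_le_left

theorem starProjection_differenceSpace :
    (fun n => (differenceSpace π ξ 𝒜 n).starProjection) = differenceProj π ξ 𝒜 := by
  funext n
  cases n with
  | zero => rfl
  | succ n =>
    have : (filtrationSpace π ξ 𝒜 (n + 1) ⊓ (filtrationSpace π ξ 𝒜 n)ᗮ).HasOrthogonalProjection :=
      inferInstanceAs (differenceSpace π ξ 𝒜 (n + 1)).HasOrthogonalProjection
    exact Submodule.starProjection_inf_orthogonal (filtrationSpace_mono π ξ 𝒜 n.le_succ)

theorem orthogonalFamily_differenceSpace :
    OrthogonalFamily ℂ (fun n => differenceSpace π ξ 𝒜 n)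
      fun n => (differenceSpace π ξ 𝒜 n).subtypeₗᵢ := by
  have key : ∀ m n, m < n → ∀ x ∈ differenceSpace π ξ 𝒜 m, ∀ y ∈ differenceSpace π ξ 𝒜 n,
      inner ℂ x y = 0 := by
    intro m n hmn x hx y hy
    obtain ⟨k, rfl⟩ := Nat.exists_eq_succ_of_ne_zero (Nat.ne_zero_of_lt hmn)
    exact hy.2 x (filtrationSpace_mono π ξ 𝒜 (Nat.lt_succ_iff.1 hmn)
      (differenceSpace_le_filtrationSpace π ξ 𝒜 m hx))
  intro m n hmn x y
  rcases lt_or_gt_of_ne hmn with h | h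
  · exact key m n h x x.2 y y.2
  · exact inner_eq_zero_symm.1 (key n m h y y.2 x x.2)

theorem filtrationSpace_le_iSup_differenceSpace (n : ℕ) :
    filtrationSpace π ξ 𝒜 n ≤ ⨆ m, differenceSpace π ξ 𝒜 m := by
  induction n with
  | zero => exact le_iSup (differenceSpace π ξ 𝒜) 0
  | succ n ih =>
    intro x hx
    have h1 := ih ((filtrationSpace π ξ 𝒜 n).starProjection_apply_mem x)
    have h2 : x - (filtrationSpace π ξ 𝒜 n).starProjection x ∈ differenceSpace π ξ 𝒜 (n + 1) :=
      ⟨Submodule.sub_mem _ hx (filtrationSpace_mono π ξ 𝒜 n.le_succ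
        (Submodule.starProjection_apply_mem _ x)), Submodule.sub_starProjection_mem_orthogonal x⟩
    rw [← add_sub_cancel ((filtrationSpace π ξ 𝒜 n).starProjection x) x]
    exact Submodule.add_mem _ h1 (Submodule.mem_iSup_of_mem _ h2)

theorem continuous_orbitMap : Continuous (orbitMap π ξ) :=
  (ContinuousLinearMap.apply ℂ H ξ).continuous.comp <|
    AddMonoidHomClass.continuous_of_bound π 1 fun a => by
      simpa using NonUnitalStarAlgHom.norm_apply_le π a

variable {π ξ}

theorem top_le_closure_iSup_filtrationSpace (hcyc : IsCyclicVector π ξ) :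
    ⊤ ≤ (⨆ n, filtrationSpace π ξ 𝒜 n).topologicalClosure := by
  have h := DenseRange.dense_image (f := orbitMap π ξ) hcyc (continuous_orbitMap π ξ) 𝒜.dense
  rw [top_le_iff, ← Submodule.dense_iff_topologicalClosure_eq_top]
  refine h.mono ?_
  rintro _ ⟨a, ha, rfl⟩
  obtain ⟨n, hn⟩ := Set.mem_iUnion.1 ha
  exact Submodule.mem_iSup_of_mem n ⟨a, hn, rfl⟩

theorem top_le_closure_iSup_differenceSpace (hcyc : IsCyclicVector π ξ) :
    ⊤ ≤ (⨆ n, differenceSpace π ξ 𝒜 n).topologicalClosure :=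
  (top_le_closure_iSup_filtrationSpace 𝒜 hcyc).trans <| Submodule.topologicalClosure_mono <|
    iSup_le (filtrationSpace_le_iSup_differenceSpace π ξ 𝒜)

theorem isProjectionResolution_differenceProj (hcyc : IsCyclicVector π ξ) :
    IsProjectionResolution (differenceProj π ξ 𝒜) := by
  rw [← starProjection_differenceSpace]
  exact (orthogonalFamily_differenceSpace π ξ 𝒜).isProjectionResolution
    (top_le_closure_iSup_differenceSpace 𝒜 hcyc)

theorem differenceProj_eq_self_iff {n : ℕ} {x : H} :
    differenceProj π ξ 𝒜 n x = x ↔ x ∈ differenceSpace π ξ 𝒜 n := by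
  rw [← starProjection_differenceSpace]
  exact Submodule.starProjection_eq_self_iff

theorem differenceProj_apply_mem (n : ℕ) (x : H) :
    differenceProj π ξ 𝒜 n x ∈ differenceSpace π ξ 𝒜 n := by
  rw [← starProjection_differenceSpace]
  exact Submodule.starProjection_apply_mem _ x

theorem isCompactOperator_differenceProj (n : ℕ) :
    IsCompactOperator (differenceProj π ξ 𝒜 n) := by
  rw [← starProjection_differenceSpace]
  have : IsCompactOperator (id : differenceSpace π ξ 𝒜 n → differenceSpace π ξ 𝒜 n) :=
    have := FiniteDimensional.proper ℂ (differenceSpace π ξ 𝒜 n)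
    isCompactOperator_id
  exact (this.clm_comp (differenceSpace π ξ 𝒜 n).subtypeL).comp_clm
    (differenceSpace π ξ 𝒜 n).orthogonalProjectionOnto

theorem mem_differenceSpace_zero : ξ ∈ differenceSpace π ξ 𝒜 0 :=
  ⟨1, (𝒜.alg 0).one_mem, by simp [orbitMap]⟩

variable {𝒜}

theorem apply_mem_filtrationSpace {a : A} {n : ℕ} (ha : a ∈ 𝒜.alg n) {x : H}
    (hx : x ∈ filtrationSpace π ξ 𝒜 n) : π a x ∈ filtrationSpace π ξ 𝒜 n := by
  obtain ⟨b, hb, rfl⟩ := hx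
  exact ⟨a * b, (𝒜.alg n).mul_mem ha hb, by simp [orbitMap]⟩

/-- `H_n` is invariant under `a` and under `star a`, hence reduces `a`. -/
theorem starProjection_filtrationSpace_comm {a : A} {n : ℕ} (ha : a ∈ 𝒜.alg n) (x : H) :
    (filtrationSpace π ξ 𝒜 n).starProjection (π a x) =
      π a ((filtrationSpace π ξ 𝒜 n).starProjection x) := by
  refine Submodule.eq_starProjection_of_mem_orthogonal
    (apply_mem_filtrationSpace ha (Submodule.starProjection_apply_mem _ x)) ?_
  rw [← map_sub]
  intro y hy
  rw [← ContinuousLinearMap.adjoint_inner_left, ← ContinuousLinearMap.star_eq_adjoint, ← map_star]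
  exact Submodule.sub_starProjection_mem_orthogonal x _
    (apply_mem_filtrationSpace (star_mem ha) hy)

/-- The strict inequality makes `a` commute with `P_{n-1}` as well as with `P_n`. -/
theorem differenceProj_comm {a : A} {m n : ℕ} (ha : a ∈ 𝒜.alg m) (hmn : m < n) (x : H) :
    differenceProj π ξ 𝒜 n (π a x) = π a (differenceProj π ξ 𝒜 n x) := by
  obtain ⟨k, rfl⟩ := Nat.exists_eq_succ_of_ne_zero (Nat.ne_zero_of_lt hmn)
  change (filtrationSpace π ξ 𝒜 (k + 1)).starProjection (π a x) -
    (filtrationSpace π ξ 𝒜 k).starProjection (π a x) = π a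
      ((filtrationSpace π ξ 𝒜 (k + 1)).starProjection x - (filtrationSpace π ξ 𝒜 k).starProjection x)
  rw [starProjection_filtrationSpace_comm (𝒜.mono hmn.le ha),
    starProjection_filtrationSpace_comm (𝒜.mono (Nat.lt_succ_iff.1 hmn) ha), map_sub]

/-- As `A` is infinite-dimensional, infinitely many of the spaces `F_n` are nonzero. -/
theorem exists_differenceSpace_ne_bot (hA : ¬ FiniteDimensional ℂ A) (hsep : IsSeparatingVector π ξ)
    (hcyc : IsCyclicVector π ξ) (N : ℕ) : ∃ n, N ≤ n ∧ differenceSpace π ξ 𝒜 n ≠ ⊥ := by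
  by_contra! h
  have hle : ∀ n, differenceSpace π ξ 𝒜 n ≤ filtrationSpace π ξ 𝒜 N := by
    intro n
    rcases le_or_gt N n with hn | hn
    · rw [h n hn]; exact bot_le
    · exact (differenceSpace_le_filtrationSpace π ξ 𝒜 n).trans (filtrationSpace_mono π ξ 𝒜 hn.le)
  -- If all later differences vanish, the finite-dimensional, hence closed, space `H_N` is all of
  -- `H`; then `A` embeds into it by `a ↦ a ξ`.
  have htop : filtrationSpace π ξ 𝒜 N = ⊤ := by
    refine top_le_iff.1 ((top_le_closure_iSup_differenceSpace 𝒜 hcyc).trans ?_)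
    refine (Submodule.topologicalClosure_mono (iSup_le hle)).trans ?_
    exact (Submodule.closed_of_finiteDimensional _).submodule_topologicalClosure_eq.le
  have hfin : FiniteDimensional ℂ H := by
    have : FiniteDimensional ℂ (⊤ : Submodule ℂ H) := htop ▸ inferInstance
    exact Module.finite_def.2 (Submodule.fg_top _ |>.1 (Module.finite_def.1 this))
  refine hA (FiniteDimensional.of_injective (orbitMap π ξ) ?_)
  rw [← LinearMap.ker_eq_bot, LinearMap.ker_eq_bot']
  exact hsep

end Filtration

/-! ### Functional calculus on eigenvectors and the trace -/

section Summability

variable {H : Type*} [NormedAddCommGroup H] [InnerProductSpace ℂ H]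

/-- Clear for polynomials in `R`; both sides are continuous in the function on the spectrum, so
Stone–Weierstrass extends it. -/
theorem cfc_apply_of_eigenvector [CompleteSpace H] {R : H →L[ℂ] H} (hR : IsSelfAdjoint R) {t : ℝ}
    {x : H} (hx : x ≠ 0) (h : R x = (t : ℂ) • x) {f : ℝ → ℝ} (hf : Continuous f) :
    cfc f R x = (f t : ℂ) • x := by
  have ht : t ∈ spectrum ℝ R := by
    rw [spectrum.mem_iff]
    intro hu
    obtain ⟨S, hS⟩ := hu.exists_left_inv
    have h0 : (algebraMap ℝ (H →L[ℂ] H) t - R) x = 0 := by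
      rw [Algebra.algebraMap_eq_smul_one]
      simp [h]
    have h1 := congr($hS x)
    rw [mul_apply_eq_comp, h0, map_zero] at h1
    exact hx h1.symm
  have key : ∀ g : C(spectrum ℝ R, ℝ), cfcHom hR g x = (g ⟨t, ht⟩ : ℂ) • x := by
    intro g
    induction g using ContinuousMap.induction_on_of_compact with
    | const r =>
      have : ContinuousMap.const (spectrum ℝ R) r = algebraMap ℝ C(spectrum ℝ R, ℝ) r := rfl
      rw [this, AlgHomClass.commutes, Algebra.algebraMap_eq_smul_one]
      simp
    | id => rw [cfcHom_id]; simpa using h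
    | star_id => rw [star_trivial, cfcHom_id]; simpa using h
    | add f g hf hg =>
      rw [map_add, add_apply, hf, hg, ← add_smul]; simp
    | mul f g hf hg =>
      rw [map_mul, mul_apply_eq_comp, hg, map_smul, hf, smul_smul, mul_comm]; simp
    | frequently f hf =>
      refine hf.mem_of_closed (s := {g : C(spectrum ℝ R, ℝ) | cfcHom hR g x = (g ⟨t, ht⟩ : ℂ) • x})
        (isClosed_eq ?_ ?_)
      · exact (ContinuousLinearMap.apply ℂ H x).continuous.comp (cfcHom_continuous hR)
      · exact (Complex.continuous_ofReal.comp (continuous_eval_const _)).smul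
          continuous_const
  rw [cfc_apply f R hR hf.continuousOn, key]
  rfl

variable [CompleteSpace H] {F : ℕ → Submodule ℂ H} [∀ n, FiniteDimensional ℂ (F n)]

/-- A Hilbert sum of finite-dimensional subspaces has a Hilbert basis, indexed by a set of vectors,
that is a union of orthonormal bases of the subspaces. -/
theorem OrthogonalFamily.exists_hilbertBasis
    (hF : OrthogonalFamily ℂ (fun n => F n) fun n => (F n).subtypeₗᵢ)
    (htot : ⊤ ≤ (⨆ n, F n).topologicalClosure) :
    ∃ (w : Set H) (e : (Σ n, Fin (Module.finrank ℂ (F n))) ≃ w) (b : HilbertBasis w ℂ H),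
      ∀ i, b (e i) ∈ F i.1 := by
  let v : (Σ n, Fin (Module.finrank ℂ (F n))) → H := fun i =>
    (stdOrthonormalBasis ℂ (F i.1) i.2 : H)
  have hv : Orthonormal ℂ v := hF.orthonormal_sigma_orthonormal
    (v_family := fun n => stdOrthonormalBasis ℂ (F n))
    fun n => (stdOrthonormalBasis ℂ (F n)).orthonormal
  let e := Equiv.ofInjective v hv.linearIndependent.injective
  have hv' : Orthonormal ℂ (v ∘ e.symm) := hv.comp _ e.symm.injective
  have hspan : ⊤ ≤ (Submodule.span ℂ (Set.range (v ∘ e.symm))).topologicalClosure := by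
    refine htot.trans (Submodule.topologicalClosure_mono (iSup_le fun n => ?_))
    rw [e.symm.surjective.range_comp]
    have h1 := (stdOrthonormalBasis ℂ (F n)).toBasis.span_eq
    have h2 := congrArg (Submodule.map (F n).subtype) h1
    rw [Submodule.map_span, Submodule.map_top, Submodule.range_subtype] at h2
    rw [← h2]
    refine Submodule.span_mono ?_
    rintro _ ⟨_, ⟨i, rfl⟩, rfl⟩
    exact ⟨⟨n, i⟩, by simp [v]⟩
  refine ⟨Set.range v, e, HilbertBasis.mk hv' hspan, fun i => ?_⟩
  rw [HilbertBasis.coe_mk, Function.comp_apply, Equiv.symm_apply_apply]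
  exact (stdOrthonormalBasis ℂ (F i.1) i.2).2

/-- In a basis adapted to the `F n` the power of the resolvent is diagonal, with entry `((1 + α n ^
2)⁻¹) ^ (p / 2)` repeated `dim (F n)` times. -/
theorem OrthogonalFamily.isPSummable_diagonalOperator
    (hF : OrthogonalFamily ℂ (fun n => F n) fun n => (F n).subtypeₗᵢ)
    (htot : ⊤ ≤ (⨆ n, F n).topologicalClosure) {α : ℕ → ℝ} {p : ℝ} (hp : 0 < p)
    (hc : Summable fun n => |(1 + α n ^ 2)⁻¹|)
    (hc' : Summable fun n => |α n * (1 + α n ^ 2)⁻¹|)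
    (hsum : Summable fun n => (Module.finrank ℂ (F n) : ℝ) * ((1 + α n ^ 2)⁻¹) ^ (p / 2)) :
    IsPSummable (diagonalOperator (fun n => (F n).starProjection) α) p := by
  have hQ := hF.isProjectionResolution htot
  obtain ⟨w, e, b, hb⟩ := hF.exists_hilbertBasis htot
  refine ⟨_, hQ.isInverseOneAddSq_diagonalOperator hc hc', w, b, ?_⟩
  rw [← e.summable_iff]
  have hval : ∀ i : Σ n, Fin (Module.finrank ℂ (F n)),
      (inner ℂ (b (e i)) (cfc (fun t : ℝ => t ^ (p / 2))
        (∑' n, (((1 + α n ^ 2)⁻¹ : ℝ) : ℂ) • (F n).starProjection) (b (e i)))).re =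
      ((1 + α i.1 ^ 2)⁻¹) ^ (p / 2) := by
    intro i
    have hnorm : ‖b (e i)‖ = 1 := b.orthonormal.1 (e i)
    rw [cfc_apply_of_eigenvector (hQ.isSelfAdjoint_tsum_smul)
      (by rw [← norm_ne_zero_iff, hnorm]; exact one_ne_zero)
      (hQ.tsum_smul_apply_of_proj_eq hc (Submodule.starProjection_eq_self_iff.2 (hb i)))
      (Real.continuous_rpow_const (by positivity)), inner_smul_right,
      inner_self_eq_norm_sq_to_K, hnorm]
    simp
  have hfun : ((fun i : w => (inner ℂ (b i) (cfc (fun t : ℝ => t ^ (p / 2))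
        (∑' n, (((1 + α n ^ 2)⁻¹ : ℝ) : ℂ) • (F n).starProjection) (b i))).re) ∘ e) =
      fun i => ((1 + α i.1 ^ 2)⁻¹) ^ (p / 2) := funext hval
  rw [hfun, summable_sigma_of_nonneg fun i => by positivity]
  exact ⟨fun n => Summable.of_finite, by simpa using hsum⟩

end Summability

/-! ### Commutators with `D` and the Lipschitz ball -/

section Dirac

variable {A H : Type*} [CStarAlgebra A] [NormedAddCommGroup H] [InnerProductSpace ℂ H]
  [CompleteSpace H]

omit [CompleteSpace H] in
theorem CommutatorBound.mono {D : H →ₗ.[ℂ] H} {T : H →L[ℂ] H} {C C' : ℝ}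
    (h : CommutatorBound D T C) (hC : C ≤ C') : CommutatorBound D T C' := by
  obtain ⟨h1, h2⟩ := h
  exact ⟨h1, fun x hx => (h2 x hx).trans (mul_le_mul_of_nonneg_right hC (norm_nonneg x))⟩

omit [CompleteSpace H] in
theorem CommutatorBound.smul {D : H →ₗ.[ℂ] H} {T : H →L[ℂ] H} {C : ℝ}
    (h : CommutatorBound D T C) (c : ℂ) : CommutatorBound D (c • T) (‖c‖ * C) := by
  obtain ⟨h1, h2⟩ := h
  refine ⟨fun x hx => D.domain.smul_mem c (h1 x hx), fun x hx => ?_⟩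
  have : D ⟨(c • T) x, D.domain.smul_mem c (h1 x hx)⟩ = c • D ⟨T x, h1 x hx⟩ :=
    D.map_smul c ⟨T x, h1 x hx⟩
  rw [this, smul_apply, ← smul_sub, norm_smul, mul_assoc]
  exact mul_le_mul_of_nonneg_left (h2 x hx) (norm_nonneg c)

theorem zero_mem_lipschitzBall (π : A →⋆ₐ[ℂ] (H →L[ℂ] H)) (D : H →ₗ.[ℂ] H) :
    (0 : A) ∈ lipschitzBall π D := by
  refine ⟨IsSelfAdjoint.zero A, fun x _ => by simp, fun x hx => ?_⟩
  have h0 : (⟨π 0 x, by simp⟩ : D.domain) = 0 := Subtype.ext (by simp)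
  rw [h0, D.map_zero]
  simp

/-- A self-adjoint element with bounded commutator is a multiple of an element of the Lipschitz
ball. -/
theorem mem_span_lipschitzBall_of_isSelfAdjoint {π : A →⋆ₐ[ℂ] (H →L[ℂ] H)} {D : H →ₗ.[ℂ] H} {a : A}
    {C : ℝ} (ha : IsSelfAdjoint a) (h : CommutatorBound D (π a) C) :
    a ∈ Submodule.span ℂ (lipschitzBall π D) := by
  set r : ℝ := |C| + 1
  have hr : 0 < r := by positivity
  have hmem : ((r⁻¹ : ℝ) : ℂ) • a ∈ lipschitzBall π D := by
    refine ⟨IsSelfAdjoint.smul (Complex.conj_ofReal _) ha, ?_⟩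
    rw [map_smul]
    refine (h.smul _).mono ?_
    rw [Complex.norm_real, Real.norm_of_nonneg (by positivity), inv_mul_le_iff₀ hr, mul_one]
    linarith [le_abs_self C]
  have : a = (r : ℂ) • ((r⁻¹ : ℝ) : ℂ) • a := by
    rw [smul_smul, Complex.ofReal_inv, mul_inv_cancel₀ (by exact_mod_cast hr.ne'), one_smul]
  rw [this]
  exact Submodule.smul_mem _ _ (Submodule.subset_span hmem)

variable {π : A →⋆ₐ[ℂ] (H →L[ℂ] H)} {ξ : H} {𝒜 : AFSequence A}

/-- Only the terms with `n ≤ m` contribute to the commutator, so no growth condition on `α` is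
needed. -/
theorem exists_commutatorBound_diracOperator (hcyc : IsCyclicVector π ξ) (α : ℕ → ℝ) {a : A}
    {m : ℕ} (ha : a ∈ 𝒜.alg m) : ∃ C, CommutatorBound (diracOperator π ξ 𝒜 α) (π a) C := by
  have hQ := isProjectionResolution_differenceProj 𝒜 hcyc
  set Q := differenceProj π ξ 𝒜
  have hcomm : ∀ x, ∀ n ∉ Finset.range (m + 1), (α n : ℂ) • Q n (π a x) = π a ((α n : ℂ) • Q n x) := by
    intro x n hn
    rw [map_smul, differenceProj_comm ha (by simpa using hn)]
  have hdom : ∀ x ∈ (diracOperator π ξ 𝒜 α).domain, π a x ∈ (diracOperator π ξ 𝒜 α).domain := by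
    intro x hx
    have hs : Summable fun n => π a ((α n : ℂ) • Q n x) :=
      (Summable.hasSum (f := fun n => (α n : ℂ) • Q n x) hx).mapL (π a) |>.summable
    refine (summable_nat_add_iff (f := fun n => (α n : ℂ) • Q n (π a x)) (m + 1)).1 ?_
    convert (summable_nat_add_iff (m + 1)).2 hs using 2 with n
    exact hcomm x _ (by simp only [Finset.mem_range]; omega)
  refine ⟨∑ n ∈ Finset.range (m + 1), 2 * (|α n| * ‖π a‖), hdom, fun x hx => ?_⟩
  have h1 : HasSum (fun n => π a ((α n : ℂ) • Q n x)) (π a (diracOperator π ξ 𝒜 α ⟨x, hx⟩)) :=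
    (Summable.hasSum (f := fun n => (α n : ℂ) • Q n x) hx).mapL (π a)
  have h2 : HasSum (fun n => (α n : ℂ) • Q n (π a x)) (diracOperator π ξ 𝒜 α ⟨π a x, hdom x hx⟩) :=
    Summable.hasSum (f := fun n => (α n : ℂ) • Q n (π a x)) (hdom x hx)
  have h3 : HasSum (fun n => (α n : ℂ) • Q n (π a x) - π a ((α n : ℂ) • Q n x))
      (∑ n ∈ Finset.range (m + 1), ((α n : ℂ) • Q n (π a x) - π a ((α n : ℂ) • Q n x))) :=
    hasSum_sum_of_ne_finset_zero fun n hn => by rw [hcomm x n hn, sub_self]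
  rw [(h2.sub h1).unique h3, Finset.sum_mul]
  refine norm_sum_le_of_le _ fun n _ => ?_
  have h4 : ‖Q n (π a x)‖ ≤ ‖π a‖ * ‖x‖ := (hQ.norm_le n _).trans ((π a).le_opNorm x)
  have h5 : ‖π a (Q n x)‖ ≤ ‖π a‖ * ‖x‖ := ((π a).le_opNorm _).trans
    (mul_le_mul_of_nonneg_left (hQ.norm_le n x) (norm_nonneg _))
  rw [map_smul, ← smul_sub, norm_smul, Complex.norm_real, Real.norm_eq_abs]
  calc |α n| * ‖Q n (π a x) - π a (Q n x)‖ ≤ |α n| * (‖π a‖ * ‖x‖ + ‖π a‖ * ‖x‖) :=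
        mul_le_mul_of_nonneg_left ((norm_sub_le _ _).trans (add_le_add h4 h5)) (abs_nonneg _)
    _ = _ := by ring

theorem dense_span_lipschitzBall (hcyc : IsCyclicVector π ξ) (α : ℕ → ℝ) :
    Dense (Submodule.span ℂ (lipschitzBall π (diracOperator π ξ 𝒜 α)) : Set A) := by
  refine 𝒜.dense.mono ?_
  intro a ha
  obtain ⟨m, hm⟩ := Set.mem_iUnion.1 ha
  have key : ∀ b ∈ 𝒜.alg m, IsSelfAdjoint b →
      b ∈ Submodule.span ℂ (lipschitzBall π (diracOperator π ξ 𝒜 α)) := fun b hb hsa => by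
    obtain ⟨C, hC⟩ := exists_commutatorBound_diracOperator hcyc α hb
    exact mem_span_lipschitzBall_of_isSelfAdjoint hsa hC
  have hre : (realPart a : A) ∈ 𝒜.alg m := by
    rw [realPart_apply_coe]
    rw [← Complex.coe_smul]
    exact SMulMemClass.smul_mem _ (add_mem hm (star_mem hm))
  have him : (imaginaryPart a : A) ∈ 𝒜.alg m := by
    rw [imaginaryPart_apply_coe]
    rw [← Complex.coe_smul]
    exact SMulMemClass.smul_mem (-Complex.I) (SMulMemClass.smul_mem _ (sub_mem hm (star_mem hm)))
  rw [← realPart_add_I_smul_imaginaryPart a]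
  exact add_mem (key _ hre (realPart a).2) (Submodule.smul_mem _ _ (key _ him (imaginaryPart a).2))

variable (𝒜) in
/-- On the finite-dimensional algebra `A_n` the norms `‖b‖` and `‖b ξ‖` are equivalent. -/
theorem exists_norm_le_mul_norm_apply (hsep : IsSeparatingVector π ξ) (n : ℕ) :
    ∃ c : ℝ, 0 ≤ c ∧ ∀ b ∈ 𝒜.alg n, ‖b‖ ≤ c * ‖π b ξ‖ := by
  have : FiniteDimensional ℂ (𝒜.alg n).toSubalgebra.toSubmodule := 𝒜.finiteDimensional n
  obtain ⟨K, _, hK⟩ := LinearMap.exists_antilipschitzWith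
    ((orbitMap π ξ).domRestrict (𝒜.alg n).toSubalgebra.toSubmodule) (by
      rw [LinearMap.ker_eq_bot']
      exact fun b hb => Subtype.ext (hsep b hb))
  refine ⟨K, K.2, fun b hb => ?_⟩
  have := hK.le_mul_dist ⟨b, hb⟩ 0
  simpa [orbitMap] using this

theorem norm_differenceProj_apply_le (hcyc : IsCyclicVector π ξ) (hξ : ‖ξ‖ = 1) {α : ℕ → ℝ}
    (h0 : α 0 = 0) {a : A} (ha : CommutatorBound (diracOperator π ξ 𝒜 α) (π a) 1) (n : ℕ) :
    |α n| * ‖differenceProj π ξ 𝒜 n (π a ξ)‖ ≤ 1 := by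
  have hQ := isProjectionResolution_differenceProj 𝒜 hcyc
  have hξ0 : differenceProj π ξ 𝒜 0 ξ = ξ :=
    (differenceProj_eq_self_iff 𝒜).2 (mem_differenceSpace_zero 𝒜)
  obtain ⟨hx, hDx⟩ := hQ.exists_diagonalOperator_proj_eq α 0 ξ
  simp only [hξ0] at hx hDx
  obtain ⟨hdom, hb⟩ := ha
  have h1 := hb ξ hx
  have hDξ : diracOperator π ξ 𝒜 α ⟨ξ, hx⟩ = 0 := hDx.trans (by simp [h0])
  rw [hDξ, map_zero, sub_zero, hξ, one_mul] at h1
  have h2 := hQ.proj_diagonalOperator α ⟨π a ξ, hdom ξ hx⟩ n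
  rw [← Real.norm_eq_abs, ← Complex.norm_real, ← norm_smul, ← h2]
  exact (hQ.norm_le n _).trans h1

theorem precompactModScalars_lipschitzBall (hξ : ‖ξ‖ = 1) (hsep : IsSeparatingVector π ξ)
    (hcyc : IsCyclicVector π ξ) {α r c : ℕ → ℝ} (h0 : α 0 = 0) (hpos : ∀ n, 1 ≤ n → 0 < α n)
    (hc : ∀ n, 0 ≤ c n ∧ ∀ b ∈ 𝒜.alg n, ‖b‖ ≤ c n * ‖π b ξ‖)
    (hr : Summable r) (hcr : ∀ n, 1 ≤ n → c n / α n ≤ r n) :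
    PrecompactModScalars (lipschitzBall π (diracOperator π ξ 𝒜 α)) := by
  have hQ := isProjectionResolution_differenceProj 𝒜 hcyc
  have hfd := 𝒜.finiteDimensional
  have hproper : ∀ n, ProperSpace (𝒜.alg n) := fun n => FiniteDimensional.proper ℂ (𝒜.alg n)
  -- Tychonoff makes `K` compact, and summability of `r` makes summation continuous on it. The shift
  -- to `n + 1` omits the scalar component in `A_0`, the only one that the commutator does not
  -- bound.
  let K : Set (∀ n, 𝒜.alg (n + 1)) := Set.univ.pi fun n => Metric.closedBall 0 (r (n + 1))
  have hK : IsCompact K := isCompact_univ_pi fun n => isCompact_closedBall _ _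
  let f : (∀ n, 𝒜.alg (n + 1)) → A := fun x => ∑' n, (x n : A)
  have hf : ContinuousOn f K := by
    refine continuousOn_tsum (fun n => ?_) ((summable_nat_add_iff 1).2 hr) fun n x hx => ?_
    · exact (continuous_subtype_val.comp (continuous_apply n)).continuousOn
    · simpa using hx n (Set.mem_univ n)
  have hcomp : IsCompact ((Submodule.span ℂ {(1 : A)}).mkQ '' (f '' K)) :=
    (hK.image_of_continuousOn hf).image continuous_quot_mk
  refine hcomp.totallyBounded.subset ?_
  rintro _ ⟨a, ha, rfl⟩
  have hcomp : ∀ n, ∃ b ∈ 𝒜.alg n, π b ξ = differenceProj π ξ 𝒜 n (π a ξ) := fun n =>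
    mem_filtrationSpace_iff.1
      (differenceSpace_le_filtrationSpace π ξ 𝒜 n (differenceProj_apply_mem 𝒜 n _))
  choose b hb hbξ using hcomp
  have hnorm : ∀ n, 1 ≤ n → ‖b n‖ ≤ r n := fun n hn => by
    refine le_trans ?_ (hcr n hn)
    have h1 := norm_differenceProj_apply_le hcyc hξ h0 ha.2 n
    rw [abs_of_pos (hpos n hn), ← hbξ] at h1
    rw [le_div_iff₀ (hpos n hn)]
    calc ‖b n‖ * α n ≤ c n * ‖π (b n) ξ‖ * α n :=
          mul_le_mul_of_nonneg_right ((hc n).2 _ (hb n)) (hpos n hn).le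
      _ = c n * (α n * ‖π (b n) ξ‖) := by ring
      _ ≤ c n := mul_le_of_le_one_right (hc n).1 h1
  have hsum : Summable fun n => b (n + 1) :=
    Summable.of_norm_bounded ((summable_nat_add_iff 1).2 hr) fun n => hnorm _ (by omega)
  have hsum' : Summable b := (summable_nat_add_iff 1).1 hsum
  have hab : a = ∑' n, b n := by
    have h1 : HasSum (fun n => π (b n) ξ) (π (∑' n, b n) ξ) :=
      hsum'.hasSum.map (orbitMap π ξ) (continuous_orbitMap π ξ)
    simp only [hbξ] at h1
    have h2 : π (a - ∑' n, b n) ξ = 0 := by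
      rw [map_sub, sub_apply, (hQ.hasSum (π a ξ)).unique h1, sub_self]
    exact sub_eq_zero.1 (hsep _ h2)
  refine ⟨∑' n, b (n + 1), ⟨fun n => ⟨b (n + 1), hb _⟩, fun n _ => ?_, rfl⟩, ?_⟩
  · simpa using hnorm (n + 1) (by omega)
  · refine ((Submodule.Quotient.eq _).2 ?_).symm
    have : a - ∑' n, b (n + 1) = b 0 := by
      rw [hab, hsum'.tsum_eq_zero_add, add_sub_cancel_right]
    rw [this]
    have h0 := hb 0
    rw [𝒜.alg_zero, StarSubalgebra.mem_bot] at h0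
    obtain ⟨z, hz⟩ := h0
    rw [← hz, Algebra.algebraMap_eq_smul_one]
    exact Submodule.smul_mem _ _ (Submodule.mem_span_singleton_self 1)

theorem not_bounded_diracOperator (hA : ¬ FiniteDimensional ℂ A) (hsep : IsSeparatingVector π ξ)
    (hcyc : IsCyclicVector π ξ) {α : ℕ → ℝ} (hα : Filter.Tendsto α Filter.atTop Filter.atTop) :
    ¬ ∃ C : ℝ, ∀ x : (diracOperator π ξ 𝒜 α).domain,
      ‖diracOperator π ξ 𝒜 α x‖ ≤ C * ‖(x : H)‖ := by
  rintro ⟨C, hC⟩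
  obtain ⟨N, hN⟩ := (hα.eventually_gt_atTop C).exists_forall_of_atTop
  obtain ⟨n, hn, hne⟩ := exists_differenceSpace_ne_bot (𝒜 := 𝒜) hA hsep hcyc N
  obtain ⟨x, hx, hx0⟩ := Submodule.exists_mem_ne_zero_of_ne_bot hne
  obtain ⟨hd, hD⟩ :=
    (isProjectionResolution_differenceProj 𝒜 hcyc).exists_diagonalOperator_proj_eq α n x
  simp only [(differenceProj_eq_self_iff 𝒜).2 hx] at hd hD
  have h1 := hC ⟨x, hd⟩
  have hD' : diracOperator π ξ 𝒜 α ⟨x, hd⟩ = (α n : ℂ) • x := hD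
  rw [hD', norm_smul, Complex.norm_real] at h1
  have h2 := le_of_mul_le_mul_right h1 (norm_pos_iff.2 hx0)
  linarith [hN n hn, Real.le_norm_self (α n)]

/-- A strictly increasing sequence `α` of growth `α n ≥ 2 ^ n` that dominates the constants `c n`
comparing `‖b‖` and `‖b ξ‖` on `A_n` up to a factor `2 ^ n` has the required properties. -/
theorem isDiracSequence_of_le (hA : ¬ FiniteDimensional ℂ A) (hξ : ‖ξ‖ = 1)
    (hsep : IsSeparatingVector π ξ) (hcyc : IsCyclicVector π ξ) {α c : ℕ → ℝ} (hα : StrictMono α)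
    (h0 : α 0 = 0) (hc : ∀ n, 0 ≤ c n ∧ ∀ b ∈ 𝒜.alg n, ‖b‖ ≤ c n * ‖π b ξ‖)
    (hcα : ∀ n, 1 ≤ n → c n * 2 ^ n ≤ α n) (h2 : ∀ n, 1 ≤ n → 2 ^ n ≤ α n)
    (hs : Summable fun n => |(1 + α n ^ 2)⁻¹|) (hs' : Summable fun n => |α n * (1 + α n ^ 2)⁻¹|) :
    IsDiracSequence π ξ 𝒜 α := by
  have hQ := isProjectionResolution_differenceProj 𝒜 hcyc
  have hpos : ∀ n, 1 ≤ n → 0 < α n := fun n hn => h0 ▸ hα hn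
  have hpre : PrecompactModScalars (lipschitzBall π (diracOperator π ξ 𝒜 α)) :=
    precompactModScalars_lipschitzBall hξ hsep hcyc h0 hpos hc summable_geometric_two
      fun n hn => by
        rw [div_le_iff₀ (hpos n hn), one_div, inv_pow, ← div_eq_inv_mul, le_div_iff₀ (by positivity)]
        exact hcα n hn
  have htend : Filter.Tendsto α Filter.atTop Filter.atTop := by
    refine Filter.tendsto_atTop_mono' _ ?_ (tendsto_pow_atTop_atTop_of_one_lt one_lt_two)
    filter_upwards [Filter.eventually_ge_atTop 1] with n hn using h2 n hn
  exact
  { zero := h0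
    pos := hpos
    eigenspace := fun n x => (differenceProj_eq_self_iff 𝒜).symm.trans
      (hQ.exists_diagonalOperator_eq_smul_iff hα.injective n x).symm
    unbounded := not_bounded_diracOperator hA hsep hcyc htend
    fredholm :=
      { dense_domain := hQ.dense_domain α
        selfAdjoint := hQ.isSelfAdjoint_diagonalOperator α
        dense_bounded_commutator := 𝒜.dense.mono <| Set.iUnion_subset fun m _ ha =>
          exists_commutatorBound_diracOperator hcyc α ha
        compact_resolvent := ⟨_, hQ.isInverseOneAddSq_diagonalOperator hs hs',
          hQ.isCompactOperator_tsum_smul hs (isCompactOperator_differenceProj 𝒜)⟩ }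
    separates := separatesStates_of_dense_span (dense_span_lipschitzBall hcyc α)
    precompact := hpre
    metric := inducesWeakStarMetric_of_dense_span (zero_mem_lipschitzBall π _) hpre
      (dense_span_lipschitzBall hcyc α) }

end Dirac

/-! ### Choice of the eigenvalues -/

theorem exists_strictMono_ge (m : ℕ → ℝ) :
    ∃ α : ℕ → ℝ, StrictMono α ∧ α 0 = 0 ∧ ∀ n, 1 ≤ n → m n ≤ α n := by
  refine ⟨fun n => ∑ k ∈ Finset.range n, (|m (k + 1)| + 1), strictMono_nat_of_lt_succ fun n => ?_,
    by simp, fun n hn => ?_⟩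
  · rw [Finset.sum_range_succ]
    linarith [abs_nonneg (m (n + 1))]
  · obtain ⟨k, rfl⟩ := Nat.exists_eq_succ_of_ne_zero (Nat.one_le_iff_ne_zero.1 hn)
    change m (k + 1) ≤ ∑ k ∈ Finset.range (k + 1), (|m (k + 1)| + 1)
    rw [Finset.sum_range_succ]
    have : 0 ≤ ∑ k ∈ Finset.range k, (|m (k + 1)| + 1) :=
      Finset.sum_nonneg fun _ _ => by positivity
    linarith [le_abs_self (m (k + 1))]

theorem theorem2p1 {A H : Type*} [CStarAlgebra A] [NormedAddCommGroup H] [InnerProductSpace ℂ H]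
    [CompleteSpace H] (hA : ¬ FiniteDimensional ℂ A) (𝒜 : AFSequence A)
    (π : A →⋆ₐ[ℂ] (H →L[ℂ] H)) (ξ : H) (hξ : ‖ξ‖ = 1)
    (hsep : IsSeparatingVector π ξ) (hcyc : IsCyclicVector π ξ) :
    (∃ α : ℕ → ℝ, IsDiracSequence π ξ 𝒜 α) ∧
    (∀ p : ℝ, 0 < p → ∃ α : ℕ → ℝ,
      IsDiracSequence π ξ 𝒜 α ∧ IsPSummable (diracOperator π ξ 𝒜 α) p) := by
  suffices h : ∀ p : ℝ, 0 < p → ∃ α : ℕ → ℝ,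
      IsDiracSequence π ξ 𝒜 α ∧ IsPSummable (diracOperator π ξ 𝒜 α) p from
    ⟨(h 1 one_pos).imp fun _ hα => hα.1, h⟩
  intro p hp
  choose c hc using exists_norm_le_mul_norm_apply 𝒜 hsep
  let d : ℕ → ℝ := fun n => Module.finrank ℂ (differenceSpace π ξ 𝒜 n)
  -- The three lower bounds serve, in order, precompactness, the resolvent and unboundedness, and
  -- `p`-summability.
  obtain ⟨α, hα, h0, hle⟩ := exists_strictMono_ge fun n =>
    max (max (c n * 2 ^ n) (2 ^ n)) ((d n * 2 ^ n) ^ p⁻¹)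
  have h2 : ∀ n, 1 ≤ n → 2 ^ n ≤ α n := fun n hn =>
    (le_max_right _ _).trans ((le_max_left _ _).trans (hle n hn))
  have hpos : ∀ n, 1 ≤ n → 0 < α n := fun n hn => h0 ▸ hα hn
  have hgeom : Summable fun n : ℕ => (1 / 2 : ℝ) ^ (n + 1) :=
    (summable_nat_add_iff 1).2 summable_geometric_two
  have hinv : ∀ n, (α (n + 1))⁻¹ ≤ (1 / 2 : ℝ) ^ (n + 1) := fun n => by
    rw [one_div, inv_pow]
    exact inv_anti₀ (by positivity) (h2 _ (by omega))
  have hs : Summable fun n => |(1 + α n ^ 2)⁻¹| := by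
    refine (summable_nat_add_iff 1).1 (Summable.of_nonneg_of_le (fun n => abs_nonneg _)
      (fun n => ?_) hgeom)
    refine le_trans ?_ (hinv n)
    rw [abs_of_nonneg (by positivity)]
    exact inv_anti₀ (hpos _ (by omega)) (by nlinarith [sq_nonneg (α (n + 1) - 1)])
  have hs' : Summable fun n => |α n * (1 + α n ^ 2)⁻¹| := by
    refine (summable_nat_add_iff 1).1 (Summable.of_nonneg_of_le (fun n => abs_nonneg _)
      (fun n => ?_) hgeom)
    refine le_trans ?_ (hinv n)
    have := hpos (n + 1) (by omega)
    rw [abs_of_nonneg (by positivity), ← div_eq_mul_inv, div_le_iff₀ (by positivity), mul_add,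
      mul_one, sq, inv_mul_cancel_left₀ this.ne']
    linarith [inv_pos.2 this]
  have hsp : Summable fun n => d n * ((1 + α n ^ 2)⁻¹) ^ (p / 2) := by
    refine (summable_nat_add_iff 1).1 (Summable.of_nonneg_of_le (fun n => by positivity)
      (fun n => ?_) hgeom)
    have hn := hpos (n + 1) (by omega)
    have h3 : ((1 + α (n + 1) ^ 2)⁻¹) ^ (p / 2) ≤ (α (n + 1) ^ p)⁻¹ := by
      rw [Real.inv_rpow (by positivity)]
      refine inv_anti₀ (by positivity) ?_
      calc α (n + 1) ^ p = (α (n + 1) ^ 2) ^ (p / 2) := by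
            rw [← Real.rpow_natCast, ← Real.rpow_mul hn.le]; congr 1; push_cast; ring
        _ ≤ _ := Real.rpow_le_rpow (by positivity) (by linarith) (by positivity)
    have h4 : d (n + 1) * 2 ^ (n + 1) ≤ α (n + 1) ^ p := by
      refine (Real.rpow_inv_le_iff_of_pos (by positivity) hn.le hp).1 ?_
      exact (le_max_right _ _).trans (hle _ (by omega))
    calc d (n + 1) * ((1 + α (n + 1) ^ 2)⁻¹) ^ (p / 2)
        ≤ d (n + 1) * (α (n + 1) ^ p)⁻¹ := mul_le_mul_of_nonneg_left h3 (by positivity)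
      _ ≤ (1 / 2 : ℝ) ^ (n + 1) := by
        rw [← div_eq_mul_inv, div_le_iff₀ (by positivity), one_div, inv_pow, ← div_eq_inv_mul,
          le_div_iff₀ (by positivity)]
        exact h4
  refine ⟨α, isDiracSequence_of_le hA hξ hsep hcyc hα h0 hc
    (fun n hn => (le_max_left _ _).trans ((le_max_left _ _).trans (hle n hn))) h2 hs hs', ?_⟩
  rw [diracOperator, ← starProjection_differenceSpace]
  exact (orthogonalFamily_differenceSpace π ξ 𝒜).isPSummable_diagonalOperator
    (top_le_closure_iSup_differenceSpace 𝒜 hcyc) hp hs hs' hsp
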